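/- **Setting.** Let $\Sigma$ (the static, time-reflection symmetric Cauchy slice) be a smooth $d$-dimensional Riemannian manifold, and let $\tilde\Sigma\supset\Sigma$ be a topological space that contains $\Sigma$ as an open subspace (in particular, the conformal completion of $\Sigma$). The conformal boundary of $\Sigma$ is $\partial\tilde\Sigma=\tilde\Sigma\setminus\Sigma$. For $a\subset\Sigma$ put $a'=\operatorname{int}(\Sigma\setminus a)$, and for a family of sets put $\Cup_i a_i=(\bigcup_i a_i)''$. The conformal boundary of $a$ is $\tilde\partial a=\delta a\cap\partial\tilde\Sigma$, where $\delta a$ is the boundary of $a$ in $\tilde\Sigma$. Two sets $a,b$ *have the same conformal boundary* if $\tilde\partial a$ and $\tilde\partial b$ have the same interior relative to $\partial\tilde\Sigma$ (that is, they agree up to edges). **Area.** For $a\subset\Sigma$ and $U\subset\Sigma$ open, $\mathcal A(a;U)\in[0,\infty]$ denotes the area of $\partial a$ inside $U$, understood as the perimeter of $a$ in $U$ (the total variation in $U$ of the indicator function of $a$, with respect to the Riemannian volume, which is the $(d-1)$-dimensional area of $\partial a\cap U$ when $\partial a$ is smooth); it is $\infty$ if $\partial a\cap U$ has positive volume. Write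 $\mathcal A(a)=\mathcal A(a;\Sigma)$. Fix a cutoff, that is, an increasing sequence of open sets $U_1\subset U_2\subset\cdots$ with $\bigcup_m U_m=\Sigma$ (the choice $U_m=\Sigma$ is allowed). **Entanglement wedges.** A generalized entanglement wedge of $a\subset\Sigma$ is an open set $e\supset a$ with the same conformal boundary as $a$, with $\mathcal A(e;U_m)<\infty$ for all $m$, and with the smallest area among all open sets $b\supset a$ that have the same conformal boundary as $a$: for every such $b$ and every $\varepsilon>0$, $\mathcal A(e;U_m)\le\mathcal A(b;U_m)+\varepsilon$ for all sufficiently large $m$. (If $\mathcal A(e)<\infty$ this says that $\mathcal A(e)\le\mathcal A(b)$ for every such $b$.) Below, $E(a)$ denotes any generalized entanglement wedge of $a$; those that are mentioned are assumed to exist, but not to be unique. **Theorem (Generalized Static Holographic Entropy Cone).** Let $a_1,\dots,a_n\subset\Sigma$ be open sets such that every $p$ in the interior of $\tilde\partial a_i$ relative to $\partial\tilde\Sigma$ has a neighbourhood $N$ in $\tilde\Sigma$ with $N\cap\Sigma\subset a_i$, and such that $$a_i\subset\Big[E\Big(\Cup_{j\ne i}a_j\Big)\Big]'\qquad\text{for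 all } i=1,\dots,n .$$ Let $\mathsf x^1,\dots,\mathsf x^n\in\{0,1\}^L$ and $\mathsf y^1,\dots,\mathsf y^n\in\{0,1\}^R$ be bit strings, and let $$v_l=\Cup_{i:\,\mathsf x^i_l=1}a_i\quad(1\le l\le L),\qquad w_r=\Cup_{i:\,\mathsf y^i_r=1}a_i\quad(1\le r\le R).$$ Let $\alpha\in\mathbb N^L$ and $\beta\in\mathbb N^R$ be strings of positive integers. Suppose that there is a map $\mathsf f:\{0,1\}^L\to\{0,1\}^R$ with $\mathsf f(0\cdots0)=0\cdots0$ and $\mathsf f(\mathsf x^i)=\mathsf y^i$ for all $i$ that is an $\alpha,\beta$ contraction map, i.e. $$\sum_{r=1}^R\beta_r\,|\mathsf f_r(\mathsf x)-\mathsf f_r(\mathsf y)|\le\sum_{l=1}^L\alpha_l\,|\mathsf x_l-\mathsf y_l|\qquad\text{for all }\mathsf x,\mathsf y\in\{0,1\}^L .$$ Then, in $[0,\infty]$, $$\sum_{l=1}^L\alpha_l\,\mathcal A[E(v_l)]\ \ge\ \sum_{r=1}^R\beta_r\,\mathcal A[E(w_r)],$$ and the inequality also holds for the cut-off areas, up to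 an error that vanishes as the cutoff is removed: for every $\varepsilon>0$ and all sufficiently large $m$, $$\sum_{r=1}^R\beta_r\,\mathcal A[E(w_r);U_m]\ \le\ \sum_{l=1}^L\alpha_l\,\mathcal A[E(v_l);U_m]+\varepsilon .$$ -/

import Mathlib

open Set Filter Topology MeasureTheory Manifold Bundle
open scoped ENNReal ContDiff

noncomputable section

namespace StaticHEC

/-! ### Wedges, complements, wedge unions -/

section Wedge

variable {M : Type*} [TopologicalSpace M]

/-- The complement `a' = int (Σ \ a)` of a region of the slice. -/
def wedgeCompl (a : Set M) : Set M := interior aᶜ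

/-- The wedge union `⋓_{i ∈ s} a i = (⋃_{i ∈ s} a i)''` of a family of regions. -/
def wedgeUnion {κ : Type*} (a : κ → Set M) (s : Set κ) : Set M :=
  wedgeCompl (wedgeCompl (⋃ i ∈ s, a i))

end Wedge

/-! ### Conformal boundaries

`ι : M → Mt` is the (open) embedding of the slice into its conformal completion `Mt`; the conformal
boundary of the slice is the complement of its image. -/

section ConformalBoundary

variable {M Mt : Type*} [TopologicalSpace Mt]

/-- The conformal boundary of `a`: the boundary of `a` in the completion, intersected with the
conformal boundary of the slice. It is regarded as a subset of the space `(range ι)ᶜ`. -/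
def conformalBoundary (ι : M → Mt) (a : Set M) : Set ↥(range ι)ᶜ :=
  Subtype.val ⁻¹' frontier (ι '' a)

/-- `a` and `b` have the same conformal boundary up to edges: the (closed) sets
`conformalBoundary ι a` and `conformalBoundary ι b` have the same interior, relative to the
conformal boundary of the slice. -/
def SameConformalBoundary (ι : M → Mt) (a b : Set M) : Prop :=
  interior (conformalBoundary ι a) = interior (conformalBoundary ι b)

/-- `a` reaches its conformal boundary in full collars: near every point of its conformal boundary
that is not on an edge, all points of the slice belong to `a`. -/
def HasCollar (ι : M → Mt) (a : Set M) : Prop :=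
  ∀ p ∈ interior (conformalBoundary ι a), ι '' a ∪ (range ι)ᶜ ∈ 𝓝 (p : Mt)

end ConformalBoundary

/-! ### Area -/

section Area

/-- The perimeter of `a` in the open set `V`, that is, the total variation in `V` of the indicator
function of `a`: the limit as `δ → 0` of the infimum of `∫_V |∇u|` over the smooth functions
`u : V → [0, 1]` at `L¹(V)`-distance at most `δ` from the indicator function of `a`.
The measure is the Riemannian volume. -/
def perimeterIn (d : ℕ) {M : Type*} [EMetricSpace M]
    [ChartedSpace (EuclideanSpace ℝ (Fin d)) M]
    [RiemannianBundle (fun x : M ↦ TangentSpace (𝓡 d) x)] [MeasurableSpace M] [BorelSpace M]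
    (a V : Set M) : ℝ≥0∞ :=
  ⨆ (δ : ℝ≥0∞) (_ : 0 < δ), ⨅ (u : M → ℝ)
    (_ : ContMDiffOn (𝓡 d) 𝓘(ℝ, ℝ) ∞ u V ∧ (∀ x ∈ V, u x ∈ Icc (0 : ℝ) 1) ∧
      ∫⁻ x in V, ‖u x - a.indicator (fun _ ↦ (1 : ℝ)) x‖ₑ ∂μHE[d] ≤ δ),
    ∫⁻ x in V, ‖mvfderiv (𝓡 d) u x‖ₑ ∂μHE[d]

open Classical in
/-- The area of the part of the boundary of `a` that lies in the open set `U`: the perimeter of `a`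
in `U` (computed as the supremum over the relatively compact open subsets of `U`).
A boundary that has positive volume in `U` has infinite area. -/
def areaIn (d : ℕ) {M : Type*} [EMetricSpace M]
    [ChartedSpace (EuclideanSpace ℝ (Fin d)) M]
    [RiemannianBundle (fun x : M ↦ TangentSpace (𝓡 d) x)] [MeasurableSpace M] [BorelSpace M]
    (a U : Set M) : ℝ≥0∞ :=
  if (μHE[d] : Measure M) (frontier a ∩ U) = 0 then
    ⨆ (V : Set M) (_ : IsOpen V ∧ IsCompact (closure V) ∧ closure V ⊆ U), perimeterIn d a V
  else ⊤

/-- The area `𝒜(a)` of the boundary of `a`. -/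
def area (d : ℕ) {M : Type*} [EMetricSpace M]
    [ChartedSpace (EuclideanSpace ℝ (Fin d)) M]
    [RiemannianBundle (fun x : M ↦ TangentSpace (𝓡 d) x)] [MeasurableSpace M] [BorelSpace M]
    (a : Set M) : ℝ≥0∞ :=
  areaIn d a univ

/-! ### Generalized entanglement wedges -/

/-- A cutoff: an increasing sequence of open sets that exhausts the slice. The constant sequence
`U n = univ` (no cutoff) is allowed. -/
structure IsCutoff {M : Type*} [TopologicalSpace M] (U : ℕ → Set M) : Prop where
  isOpen : ∀ n, IsOpen (U n)
  monotone : Monotone U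
  iUnion_eq : ⋃ n, U n = univ

/-- `e` is a generalized entanglement wedge of `a`: among the open sets that contain `a` and have
the same conformal boundary as `a`, it has the smallest area. Areas are compared with the cutoff
`U`, up to an error that vanishes as the cutoff is removed, and the cut-off areas of `e` are finite;
if `e` has finite area, then `area d e ≤ area d b` is what the comparison with `b` says. -/
structure IsEntanglementWedge (d : ℕ) {M Mt : Type*} [EMetricSpace M]
    [ChartedSpace (EuclideanSpace ℝ (Fin d)) M]
    [RiemannianBundle (fun x : M ↦ TangentSpace (𝓡 d) x)] [MeasurableSpace M] [BorelSpace M]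
    [TopologicalSpace Mt] (ι : M → Mt) (U : ℕ → Set M) (a e : Set M) : Prop where
  isOpen : IsOpen e
  subset : a ⊆ e
  sameConformalBoundary : SameConformalBoundary ι a e
  areaIn_lt_top : ∀ n, areaIn d e (U n) < ⊤
  minimal : ∀ b : Set M, IsOpen b → a ⊆ b → SameConformalBoundary ι a b →
    ∀ ε : ℝ≥0∞, 0 < ε → ∀ᶠ n in atTop, areaIn d e (U n) ≤ areaIn d b (U n) + ε

end Area

/-! ### Contraction maps -/

/-- The `α`-distance `∑ l, α l * |x l - y l|` of two bit strings. -/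
def bitDist {L : ℕ} (α : Fin L → ℕ) (x y : Fin L → Bool) : ℕ :=
  ∑ l, α l * (if x l = y l then 0 else 1)

/-- `f` is an `α,β` contraction map. -/
def IsContractionMap {L R : ℕ} (α : Fin L → ℕ) (β : Fin R → ℕ)
    (f : (Fin L → Bool) → (Fin R → Bool)) : Prop :=
  ∀ x y, bitDist β (f x) (f y) ≤ bitDist α x y

end StaticHEC

end

/-! The competitor for each `Ew r` is obtained by cutting and gluing the wedges `Ev l`. Strong
subadditivity and the minimality of the wedges `F i` allow `Ev l` to be shrunk, at arbitrarily small
cost in cut-off area, to an open set `E l` inside every `F i` with `x i l = false`. By independence,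
`a i` is then disjoint from `E l` for these `i`, and it lies in `E l` for the others. Hence `a i`
sits in the cell with bit string `x i` of the partition generated by `E`. Gluing the cells on which
bit `r` of `f` is true, and taking the interior of the closure, gives an open set containing the
wedge union `w_r`. The collars and `f 0 = 0` ensure that it has the right conformal boundary, so
minimality bounds the area of `Ew r` by its area.

The areas of the glued sets are compared in functional form, without any regularity of boundaries.
Extend bit `r` of `f` to a multilinear function `g_r` on the cube and compose it with smooth
approximations `u_l` of the indicators of the `E l`. The derivative `∂_l g_r` is a signed weighted
average of differences of `f_r` across edges in direction `l`, so the contraction property gives `∑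
β_r |∂_l g_r| ≤ α_l`. By the chain rule `∑ β_r |∇ g_r(u)| ≤ ∑ α_l |∇ u_l|` pointwise. Integrating
and refining the approximation yields `IsContractionMap.sum_perimeterIn_le` and then
`IsContractionMap.sum_areaIn_le`. The contraction (and, or) gives strong subadditivity, so the same
inequality also drives the shrinking. -/

noncomputable section

namespace StaticHEC

/-! ### Multilinear extensions of functions of bit strings -/

section MultilinearExtension

/-- The weight of the bit `b` when the bit is `true` with probability `s`. -/
def bitWeight (b : Bool) (s : ℝ) : ℝ := if b = true then s else 1 - s

/-- The derivative of `bitWeight b`. -/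
def bitSign (b : Bool) : ℝ := if b = true then 1 else -1

/-- The multilinear function on `ℝ ^ L` that agrees with `c` on bit strings. -/
def multilinearExt {L : ℕ} (c : (Fin L → Bool) → ℝ) (t : Fin L → ℝ) : ℝ :=
  ∑ x, c x * ∏ l, bitWeight (x l) (t l)

/-- The partial derivative in direction `l` of `multilinearExt c`. -/
def multilinearExtDeriv {L : ℕ} (c : (Fin L → Bool) → ℝ) (l : Fin L) (t : Fin L → ℝ) : ℝ :=
  ∑ x, c x * (bitSign (x l) * ∏ k ∈ Finset.univ.erase l, bitWeight (x k) (t k))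

variable {L R : ℕ}

lemma bitWeight_nonneg (b : Bool) {s : ℝ} (hs : s ∈ Icc (0 : ℝ) 1) : 0 ≤ bitWeight b s := by
  unfold bitWeight
  split_ifs
  exacts [hs.1, sub_nonneg.2 hs.2]

lemma abs_bitSign (b : Bool) : |bitSign b| = 1 := by
  cases b <;> simp [bitSign]

lemma bitSign_not (b : Bool) : bitSign (!b) = -bitSign b := by
  cases b <;> simp [bitSign]

lemma contDiff_bitWeight (b : Bool) {n : WithTop ℕ∞} : ContDiff ℝ n (bitWeight b) := by
  cases b
  · simpa [bitWeight] using! contDiff_const.sub contDiff_id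
  · simpa [bitWeight] using! contDiff_id

lemma hasFDerivAt_bitWeight_apply (b : Bool) (t : Fin L → ℝ) (l : Fin L) :
    HasFDerivAt (fun t : Fin L → ℝ ↦ bitWeight b (t l))
      (bitSign b • ContinuousLinearMap.proj (R := ℝ) (φ := fun _ : Fin L ↦ ℝ) l) t := by
  have h := hasFDerivAt_apply (𝕜 := ℝ) l t
  cases b
  · exact (h.const_sub 1).congr_fderiv (by ext v; simp [bitSign])
  · exact h.congr_fderiv (by ext v; simp [bitSign])

lemma hasFDerivAt_multilinearExt (c : (Fin L → Bool) → ℝ) (t : Fin L → ℝ) :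
    HasFDerivAt (multilinearExt c)
      (∑ l, multilinearExtDeriv c l t •
        ContinuousLinearMap.proj (R := ℝ) (φ := fun _ : Fin L ↦ ℝ) l) t := by
  have h : HasFDerivAt (multilinearExt c) _ t := HasFDerivAt.fun_sum fun x _ ↦
    (HasFDerivAt.finsetProd fun l (_ : l ∈ Finset.univ) ↦
      hasFDerivAt_bitWeight_apply (x l) t l).const_mul (c x)
  refine h.congr_fderiv ?_
  simp only [multilinearExtDeriv, Finset.sum_smul, Finset.smul_sum, smul_smul]
  rw [Finset.sum_comm]
  refine Finset.sum_congr rfl fun l _ ↦ Finset.sum_congr rfl fun x _ ↦ ?_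
  congr 1
  ring

lemma contDiff_multilinearExt (c : (Fin L → Bool) → ℝ) {n : WithTop ℕ∞} :
    ContDiff ℝ n (multilinearExt c) :=
  ContDiff.sum fun x _ ↦ contDiff_const.mul <| contDiff_prod fun l _ ↦
    (contDiff_bitWeight (x l)).comp (contDiff_apply ℝ ℝ l)

lemma sum_prod_bitWeight (t : Fin L → ℝ) :
    ∑ x : Fin L → Bool, ∏ l, bitWeight (x l) (t l) = 1 := by
  have h := Finset.prod_univ_sum (fun _ : Fin L ↦ (Finset.univ : Finset Bool))
    (fun l b ↦ bitWeight b (t l))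
  rw [Fintype.piFinset_univ] at h
  rw [← h]
  simp [bitWeight]

/-- The free bit `l` contributes a factor 2; every other bit has total weight 1. -/
lemma sum_prod_erase_bitWeight (l : Fin L) (t : Fin L → ℝ) :
    ∑ x : Fin L → Bool, ∏ k ∈ Finset.univ.erase l, bitWeight (x k) (t k) = 2 := by
  have h := Finset.prod_univ_sum (fun _ : Fin L ↦ (Finset.univ : Finset Bool))
    (fun k b ↦ if k = l then 1 else bitWeight b (t k))
  rw [Fintype.piFinset_univ] at h
  have h1 (k : Fin L) : (∑ b : Bool, if k = l then 1 else bitWeight b (t k)) =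
      if k = l then 2 else 1 := by
    split_ifs <;> simp [bitWeight]
  have h2 (x : Fin L → Bool) : (∏ k, if k = l then 1 else bitWeight (x k) (t k)) =
      ∏ k ∈ Finset.univ.erase l, bitWeight (x k) (t k) := by
    rw [← Finset.mul_prod_erase _ _ (Finset.mem_univ l), if_pos rfl, one_mul]
    exact Finset.prod_congr rfl fun k hk ↦ if_neg (Finset.ne_of_mem_erase hk)
  simp only [h1, h2] at h
  rw [← h]
  simp

lemma multilinearExt_mem_Icc {c : (Fin L → Bool) → ℝ} (hc : ∀ x, c x ∈ Icc (0 : ℝ) 1)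
    {t : Fin L → ℝ} (ht : ∀ l, t l ∈ Icc (0 : ℝ) 1) : multilinearExt c t ∈ Icc (0 : ℝ) 1 := by
  have hw (x : Fin L → Bool) : 0 ≤ ∏ l, bitWeight (x l) (t l) :=
    Finset.prod_nonneg fun l _ ↦ bitWeight_nonneg _ (ht l)
  refine ⟨Finset.sum_nonneg fun x _ ↦ mul_nonneg (hc x).1 (hw x), ?_⟩
  rw [← sum_prod_bitWeight t]
  exact Finset.sum_le_sum fun x _ ↦ mul_le_of_le_one_left (hw x) (hc x).2

lemma multilinearExt_bit (c : (Fin L → Bool) → ℝ) (z : Fin L → Bool) :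
    multilinearExt c (fun l ↦ if z l = true then 1 else 0) = c z := by
  have h (x : Fin L → Bool) :
      ∏ l, bitWeight (x l) (if z l = true then 1 else 0) = if x = z then 1 else 0 := by
    split_ifs with hx
    · subst hx
      refine Finset.prod_eq_one fun l _ ↦ ?_
      cases h : x l <;> simp [bitWeight]
    · obtain ⟨l, hl⟩ := Function.ne_iff.1 hx
      refine Finset.prod_eq_zero (Finset.mem_univ l) ?_
      cases h : x l <;> cases h' : z l <;> simp_all [bitWeight]
  simp [multilinearExt, h]

/-- Flip the bit `l`. -/
def flipBit (l : Fin L) (x : Fin L → Bool) : Fin L → Bool := Function.update x l (!x l)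

lemma flipBit_involutive (l : Fin L) : Function.Involutive (flipBit l) := fun x ↦ by
  simp [flipBit]

lemma bitDist_flipBit (α : Fin L → ℕ) (l : Fin L) (x : Fin L → Bool) :
    bitDist α x (flipBit l x) = α l := by
  unfold bitDist
  rw [Finset.sum_eq_single l] <;> simp +contextual [flipBit]

/-- Reindexing by the flip of bit `l` changes only the sign factor; adding the two forms of the sum
produces the differences along edges of the cube. -/
lemma multilinearExtDeriv_eq (c : (Fin L → Bool) → ℝ) (l : Fin L) (t : Fin L → ℝ) :
    2 * multilinearExtDeriv c l t = ∑ x, (c x - c (flipBit l x)) *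
      (bitSign (x l) * ∏ k ∈ Finset.univ.erase l, bitWeight (x k) (t k)) := by
  have h : multilinearExtDeriv c l t = ∑ x, -(c (flipBit l x) *
      (bitSign (x l) * ∏ k ∈ Finset.univ.erase l, bitWeight (x k) (t k))) := by
    unfold multilinearExtDeriv
    rw [← (flipBit_involutive l).bijective.sum_comp]
    refine Finset.sum_congr rfl fun x _ ↦ ?_
    have h1 : flipBit l x l = !x l := by simp [flipBit]
    have h2 : ∏ k ∈ Finset.univ.erase l, bitWeight (flipBit l x k) (t k) =
        ∏ k ∈ Finset.univ.erase l, bitWeight (x k) (t k) :=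
      Finset.prod_congr rfl fun k hk ↦ by
        rw [flipBit, Function.update_of_ne (Finset.ne_of_mem_erase hk)]
    rw [h1, h2, bitSign_not]
    ring
  rw [two_mul]
  nth_rw 2 [h]
  rw [multilinearExtDeriv, ← Finset.sum_add_distrib]
  exact Finset.sum_congr rfl fun x _ ↦ by ring

/-- The real-valued indicator of the bit `r` of `f`. -/
def bitFun (f : (Fin L → Bool) → (Fin R → Bool)) (r : Fin R) (x : Fin L → Bool) : ℝ :=
  if f x r = true then 1 else 0

lemma bitFun_mem_Icc (f : (Fin L → Bool) → (Fin R → Bool)) (r : Fin R) (x : Fin L → Bool) :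
    bitFun f r x ∈ Icc (0 : ℝ) 1 := by
  unfold bitFun
  split_ifs <;> simp

lemma sum_abs_bitFun_sub (β : Fin R → ℕ) (f : (Fin L → Bool) → (Fin R → Bool))
    (x z : Fin L → Bool) :
    ∑ r, (β r : ℝ) * |bitFun f r x - bitFun f r z| = bitDist β (f x) (f z) := by
  simp only [bitDist, Nat.cast_sum, Nat.cast_mul]
  refine Finset.sum_congr rfl fun r _ ↦ ?_
  cases h : f x r <;> cases h' : f z r <;> simp [bitFun, h, h']

/-- The multilinear extension of a contraction map is a contraction. -/
lemma IsContractionMap.sum_abs_multilinearExtDeriv_le {α : Fin L → ℕ} {β : Fin R → ℕ}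
    {f : (Fin L → Bool) → (Fin R → Bool)} (hf : IsContractionMap α β f) (l : Fin L)
    {t : Fin L → ℝ} (ht : ∀ l, t l ∈ Icc (0 : ℝ) 1) :
    ∑ r, (β r : ℝ) * |multilinearExtDeriv (bitFun f r) l t| ≤ α l := by
  set w : (Fin L → Bool) → ℝ := fun x ↦ ∏ k ∈ Finset.univ.erase l, bitWeight (x k) (t k) with hw
  have hw0 (x : Fin L → Bool) : 0 ≤ w x := Finset.prod_nonneg fun k _ ↦ bitWeight_nonneg _ (ht k)
  have h1 (r : Fin R) : 2 * |multilinearExtDeriv (bitFun f r) l t| ≤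
      ∑ x, |bitFun f r x - bitFun f r (flipBit l x)| * w x := by
    rw [← abs_two, ← abs_mul, multilinearExtDeriv_eq]
    refine (Finset.abs_sum_le_sum_abs _ _).trans_eq (Finset.sum_congr rfl fun x _ ↦ ?_)
    rw [abs_mul, abs_mul, abs_bitSign, one_mul, abs_of_nonneg (hw0 x)]
  have h2 : 2 * ∑ r, (β r : ℝ) * |multilinearExtDeriv (bitFun f r) l t| ≤ 2 * α l := calc
    _ = ∑ r, (β r : ℝ) * (2 * |multilinearExtDeriv (bitFun f r) l t|) := by
      rw [Finset.mul_sum]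
      exact Finset.sum_congr rfl fun r _ ↦ by ring
    _ ≤ ∑ r, (β r : ℝ) * ∑ x, |bitFun f r x - bitFun f r (flipBit l x)| * w x := by
      gcongr with r
      exact h1 r
    _ = ∑ x, (∑ r, (β r : ℝ) * |bitFun f r x - bitFun f r (flipBit l x)|) * w x := by
      simp only [Finset.mul_sum, Finset.sum_mul, mul_assoc]
      exact Finset.sum_comm
    -- The contraction property enters only along edges: `x` and `flipBit l x` are at distance `α
    -- l`.
    _ ≤ ∑ x, (α l : ℝ) * w x := by
      gcongr with x
      · exact hw0 x
      · rw [sum_abs_bitFun_sub]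
        exact_mod_cast (hf x (flipBit l x)).trans_eq (bitDist_flipBit α l x)
    _ = 2 * α l := by
      rw [← Finset.mul_sum, hw, sum_prod_erase_bitWeight, mul_comm]
  linarith

/-- A smooth function is Lipschitz on the compact convex cube. This turns `L¹` bounds on the inputs
into an `L¹` bound on the composite. -/
lemma exists_dist_multilinearExt_le (c : (Fin L → Bool) → ℝ) :
    ∃ K : NNReal, ∀ s t : Fin L → ℝ, (∀ l, s l ∈ Icc (0 : ℝ) 1) → (∀ l, t l ∈ Icc (0 : ℝ) 1) →
      ‖multilinearExt c s - multilinearExt c t‖ₑ ≤ K * ∑ l, ‖s l - t l‖ₑ := by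
  obtain ⟨K, hK⟩ := ((contDiff_multilinearExt c (n := 1)).contDiffOn
    (s := Icc (0 : Fin L → ℝ) 1)).exists_lipschitzOnWith one_ne_zero (convex_Icc _ _) isCompact_Icc
  refine ⟨K, fun s t hs ht ↦ ?_⟩
  have h := hK ⟨fun l ↦ (hs l).1, fun l ↦ (hs l).2⟩ ⟨fun l ↦ (ht l).1, fun l ↦ (ht l).2⟩
  rw [← edist_eq_enorm_sub]
  refine h.trans ?_
  gcongr
  refine edist_pi_le_iff.2 fun l ↦ ?_
  rw [edist_eq_enorm_sub]
  exact Finset.single_le_sum (f := fun l ↦ ‖s l - t l‖ₑ) (fun _ _ ↦ zero_le) (Finset.mem_univ l)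

end MultilinearExtension

/-! ### The norm of the differential -/

section Gradient

lemma coe_lt_enorm_iff_exists {V : Type*} [NormedAddCommGroup V] [NormedSpace ℝ V]
    (T : V →L[ℝ] ℝ) (c : NNReal) : (c : ℝ≥0∞) < ‖T‖ₑ ↔ ∃ v, c * ‖v‖ < ‖T v‖ := by
  rw [enorm_eq_nnnorm, ENNReal.coe_lt_coe, ← NNReal.coe_lt_coe, coe_nnnorm]
  constructor
  · intro h
    by_contra! h'
    exact h.not_ge (ContinuousLinearMap.opNorm_le_bound _ c.2 h')
  · rintro ⟨v, hv⟩
    by_contra! h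
    exact hv.not_ge (ContinuousLinearMap.le_of_opNorm_le _ h _)

lemma enorm_sum_smul_le {V : Type*} [NormedAddCommGroup V] [NormedSpace ℝ V] {L : ℕ}
    (c : Fin L → ℝ) (T : Fin L → V →L[ℝ] ℝ) :
    ‖∑ l, c l • T l‖ₑ ≤ ∑ l, ‖c l‖ₑ * ‖T l‖ₑ := by
  refine (enorm_sum_le (ε := V →L[ℝ] ℝ) _ _).trans_eq (Finset.sum_congr rfl fun l _ ↦ ?_)
  rw [enorm_smul]

variable {d : ℕ} {M : Type*} [EMetricSpace M] [ChartedSpace (EuclideanSpace ℝ (Fin d)) M]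

lemma mvfderiv_comp_pi {L : ℕ} {g : (Fin L → ℝ) → ℝ} {c : Fin L → ℝ} {u : Fin L → M → ℝ} {p : M}
    (hu : ∀ l, MDifferentiableAt (𝓡 d) 𝓘(ℝ, ℝ) (u l) p)
    (hg : HasFDerivAt g (∑ l, c l • ContinuousLinearMap.proj (R := ℝ) (φ := fun _ : Fin L ↦ ℝ) l)
      (fun l ↦ u l p)) :
    mvfderiv (𝓡 d) (fun q ↦ g fun l ↦ u l q) p = ∑ l, c l • mvfderiv (𝓡 d) (u l) p := by
  have h1 : HasMFDerivAt (𝓡 d) 𝓘(ℝ, Fin L → ℝ) (fun q l ↦ u l q) p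
      (ContinuousLinearMap.pi fun l ↦ mvfderiv (𝓡 d) (u l) p) :=
    ⟨continuousAt_pi.2 fun l ↦ (hu l).continuousAt,
      hasFDerivWithinAt_pi.2 fun l ↦ (hu l).hasMFDerivAt.2⟩
  have h2 := (hg.hasMFDerivAt.comp p h1).mfderiv
  ext v
  have h3 := congrArg (fun T ↦ T v) h2
  refine Eq.trans h3 ?_
  change (∑ l, c l • ContinuousLinearMap.proj (R := ℝ) (φ := fun _ : Fin L ↦ ℝ) l)
    (fun l ↦ mvfderiv (𝓡 d) (u l) p v) = _
  simp only [sum_apply, smul_apply,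
    ContinuousLinearMap.proj_apply]

variable [RiemannianBundle (fun x : M ↦ TangentSpace (𝓡 d) x)]

variable (d M) in
lemma isContinuousRiemannianBundle_tangentSpace [IsManifold (𝓡 d) 1 M]
    [h : IsContMDiffRiemannianBundle (𝓡 d) ∞ (EuclideanSpace ℝ (Fin d))
      (fun x : M ↦ TangentSpace (𝓡 d) x)] :
    IsContinuousRiemannianBundle (EuclideanSpace ℝ (Fin d))
      (fun x : M ↦ TangentSpace (𝓡 d) x) := by
  obtain ⟨g, hg, h⟩ := h.exists_contMDiff
  exact ⟨g, hg.continuous, h⟩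

variable [IsManifold (𝓡 d) ∞ M]
    [IsContMDiffRiemannianBundle (𝓡 d) ∞ (EuclideanSpace ℝ (Fin d))
      (fun x : M ↦ TangentSpace (𝓡 d) x)]

/-- A vector witnessing `c < ‖du‖` at `p` extends to a vector field continuous at `p`. Its norm and
its pairing with `du` are continuous there, so the strict inequality persists nearby. -/
lemma lowerSemicontinuousAt_enorm_mvfderiv {u : M → ℝ} {p : M} {V : Set M} (hV : IsOpen V)
    (hu : ContMDiffOn (𝓡 d) 𝓘(ℝ, ℝ) ∞ u V) (hp : p ∈ V) :
    LowerSemicontinuousAt (fun q ↦ ‖mvfderiv (𝓡 d) u q‖ₑ) p := by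
  intro c hc
  lift c to NNReal using (hc.trans_le le_top).ne
  obtain ⟨v, hv⟩ := (coe_lt_enorm_iff_exists (V := TangentSpace (𝓡 d) p) _ c).1 hc
  have : IsManifold (𝓡 d) 1 M := inferInstance
  have := isContinuousRiemannianBundle_tangentSpace d M
  let X := FiberBundle.extend (EuclideanSpace ℝ (Fin d))
    (E := fun x : M ↦ TangentSpace (𝓡 d) x) v
  have hX0 : X p = v := FiberBundle.extend_apply_self ..
  have hXc : ContinuousAt (fun q ↦ (⟨q, X q⟩ : TangentBundle (𝓡 d) M)) p :=
    (FiberBundle.mdifferentiableAt_extend (𝓡 d) (EuclideanSpace ℝ (Fin d)) v).continuousAt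
  have h1 : ContinuousAt (fun q ↦ ‖X q‖) p := by
    have := ContinuousAt.inner_bundle (F := EuclideanSpace ℝ (Fin d))
      (E := fun x : M ↦ TangentSpace (𝓡 d) x) hXc hXc
    simpa [real_inner_self_eq_norm_sq] using this.sqrt
  have h2 : ContinuousAt (fun q ↦ mvfderiv (𝓡 d) u q (X q)) p := by
    have h3 : ContinuousAt (tangentMapWithin (𝓡 d) 𝓘(ℝ, ℝ) u V)
        (⟨p, X p⟩ : TangentBundle (𝓡 d) M) :=
      (hu.continuousOn_tangentMapWithin (by simp) hV.uniqueMDiffOn).continuousAt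
        ((FiberBundle.continuous_proj _ _).isOpen_preimage V hV |>.mem_nhds hp)
    have h4 := (contMDiff_snd_tangentBundle_modelSpace ℝ 𝓘(ℝ, ℝ)
      (n := 0)).continuous.continuousAt.comp
        (h3.comp (f := fun q ↦ (⟨q, X q⟩ : TangentBundle (𝓡 d) M)) hXc)
    refine h4.congr ?_
    filter_upwards [hV.mem_nhds hp] with q hq
    change mfderivWithin (𝓡 d) 𝓘(ℝ, ℝ) u V q (X q) = mfderiv (𝓡 d) 𝓘(ℝ, ℝ) u q (X q)
    rw [mfderivWithin_of_isOpen hV hq]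
  have h5 : ∀ᶠ q in 𝓝 p, c * ‖X q‖ < ‖mvfderiv (𝓡 d) u q (X q)‖ :=
    (h1.const_mul (c : ℝ)).eventually_lt h2.norm (by simpa only [hX0] using hv)
  filter_upwards [h5] with q hq
  exact (coe_lt_enorm_iff_exists (V := TangentSpace (𝓡 d) q) _ c).2 ⟨_, hq⟩

lemma aemeasurable_enorm_mvfderiv [MeasurableSpace M] [BorelSpace M] {μ : Measure M} {u : M → ℝ}
    {V : Set M} (hV : IsOpen V) (hu : ContMDiffOn (𝓡 d) 𝓘(ℝ, ℝ) ∞ u V) :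
    AEMeasurable (fun q ↦ ‖mvfderiv (𝓡 d) u q‖ₑ) (μ.restrict V) := by
  rw [← aemeasurable_indicator_iff hV.measurableSet]
  refine (measurable_of_Ioi fun c ↦ ?_).aemeasurable
  -- After extension by zero outside `V`, a superlevel set lies in `V`, and it is open by lower
  -- semicontinuity.
  refine IsOpen.measurableSet (isOpen_iff_mem_nhds.2 fun p hp ↦ ?_)
  by_cases hpV : p ∈ V
  · have := lowerSemicontinuousAt_enorm_mvfderiv hV hu hpV c (by simpa [hpV] using hp)
    filter_upwards [this, hV.mem_nhds hpV] with q h hq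
    simpa [hq] using h
  · simp [hpV] at hp

end Gradient

/-! ### The contraction inequality for perimeters -/

section Perimeter

open Classical in
/-- The bit string that records in which of the sets `E l` the point `p` lies. -/
def membershipBits {L : ℕ} {M : Type*} (E : Fin L → Set M) (p : M) : Fin L → Bool :=
  fun l ↦ decide (p ∈ E l)

lemma membershipBits_eq_true_iff {L : ℕ} {M : Type*} {E : Fin L → Set M} {p : M} {l : Fin L} :
    membershipBits E p l = true ↔ p ∈ E l := by
  simp [membershipBits]

lemma IsContractionMap.sum_enorm_multilinearExtDeriv_le {L R : ℕ} {α : Fin L → ℕ} {β : Fin R → ℕ}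
    {f : (Fin L → Bool) → (Fin R → Bool)} (hf : IsContractionMap α β f) (l : Fin L)
    {t : Fin L → ℝ} (ht : ∀ l, t l ∈ Icc (0 : ℝ) 1) :
    ∑ r, (β r : ℝ≥0∞) * ‖multilinearExtDeriv (bitFun f r) l t‖ₑ ≤ α l := by
  have h := ENNReal.ofReal_le_ofReal (hf.sum_abs_multilinearExtDeriv_le l ht)
  rw [ENNReal.ofReal_sum_of_nonneg (fun _ _ ↦ by positivity), ENNReal.ofReal_natCast] at h
  refine le_of_eq_of_le (Finset.sum_congr rfl fun r _ ↦ ?_) h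
  rw [ENNReal.ofReal_mul (by positivity), ENNReal.ofReal_natCast, Real.enorm_eq_ofReal_abs]

variable {d : ℕ} {M : Type*} [EMetricSpace M] [ChartedSpace (EuclideanSpace ℝ (Fin d)) M]

/-- The smooth functions `V → [0, 1]` at `L¹`-distance at most `δ` from the indicator of `a`. -/
def smoothApprox (d : ℕ) {M : Type*} [EMetricSpace M]
    [ChartedSpace (EuclideanSpace ℝ (Fin d)) M] [MeasurableSpace M] [BorelSpace M]
    (δ : ℝ≥0∞) (a V : Set M) : Set (M → ℝ) :=
  {u | ContMDiffOn (𝓡 d) 𝓘(ℝ, ℝ) ∞ u V ∧ (∀ x ∈ V, u x ∈ Icc (0 : ℝ) 1) ∧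
      ∫⁻ x in V, ‖u x - a.indicator (fun _ ↦ (1 : ℝ)) x‖ₑ ∂μHE[d] ≤ δ}

lemma smoothApprox_mono [MeasurableSpace M] [BorelSpace M] {δ δ' : ℝ≥0∞} (h : δ ≤ δ')
    (a V : Set M) : smoothApprox d δ a V ⊆ smoothApprox d δ' a V :=
  fun _ hu ↦ ⟨hu.1, hu.2.1, hu.2.2.trans h⟩

/-- The indicator of `b` is the multilinear extension evaluated at the indicators of the `E l`, so
the Lipschitz bound controls the distance. The constant depends only on `c`, hence is uniform in
`δ`. -/
lemma exists_multilinearExt_mem_smoothApprox [MeasurableSpace M] [BorelSpace M] {L : ℕ}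
    (c : (Fin L → Bool) → ℝ)
    (hc : ∀ x, c x ∈ Icc (0 : ℝ) 1) :
    ∃ K : NNReal, ∀ (V : Set M) (E : Fin L → Set M) (b : Set M) (δ : ℝ≥0∞) (u : Fin L → M → ℝ),
      IsOpen V → (∀ l, MeasurableSet (E l)) →
      (∀ᵐ p ∂((μHE[d] : Measure M).restrict V),
        b.indicator (fun _ ↦ (1 : ℝ)) p = c (membershipBits E p)) →
      (∀ l, u l ∈ smoothApprox d δ (E l) V) →
      (fun p ↦ multilinearExt c fun l ↦ u l p) ∈ smoothApprox d (K * δ) b V := by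
  obtain ⟨K, hK⟩ := exists_dist_multilinearExt_le c
  refine ⟨K * L, fun V E b δ u hV hE hb hu ↦ ⟨?_, fun x hx ↦
    multilinearExt_mem_Icc hc fun l ↦ (hu l).2.1 x hx, ?_⟩⟩
  · exact (contDiff_multilinearExt c).contMDiff.comp_contMDiffOn
      (contMDiffOn_pi_space.2 fun l ↦ (hu l).1)
  · have hm (l : Fin L) : AEMeasurable (fun x ↦ ‖u l x - (E l).indicator (fun _ ↦ (1 : ℝ)) x‖ₑ)
        ((μHE[d] : Measure M).restrict V) :=
      (((hu l).1.continuousOn.aemeasurable hV.measurableSet).sub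
        (measurable_const.indicator (hE l)).aemeasurable).enorm
    calc
      _ ≤ ∫⁻ x in V, K * ∑ l, ‖u l x - (E l).indicator (fun _ ↦ (1 : ℝ)) x‖ₑ ∂μHE[d] := by
        refine lintegral_mono_ae ?_
        filter_upwards [hb, ae_restrict_mem hV.measurableSet] with x hx hxV
        rw [hx, ← multilinearExt_bit c]
        have h1 (l : Fin L) : (if membershipBits E x l = true then (1 : ℝ) else 0) =
            (E l).indicator (fun _ ↦ (1 : ℝ)) x := by
          by_cases h : x ∈ E l <;> simp [membershipBits, h]
        simp only [h1]
        refine hK _ _ (fun l ↦ (hu l).2.1 x hxV) fun l ↦ ?_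
        by_cases h : x ∈ E l <;> simp [h]
      _ = K * ∑ l, ∫⁻ x in V, ‖u l x - (E l).indicator (fun _ ↦ (1 : ℝ)) x‖ₑ ∂μHE[d] := by
        rw [lintegral_const_mul' _ _ ENNReal.coe_ne_top, lintegral_finsetSum' _ fun l _ ↦ hm l]
      _ ≤ K * ∑ l : Fin L, δ := by
        gcongr with l
        exact (hu l).2.2
      _ = _ := by
        simp [mul_assoc]

variable [RiemannianBundle (fun x : M ↦ TangentSpace (𝓡 d) x)]

lemma sum_enorm_mvfderiv_multilinearExt_le {L R : ℕ} {α : Fin L → ℕ} {β : Fin R → ℕ}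
    {f : (Fin L → Bool) → (Fin R → Bool)} (hf : IsContractionMap α β f) {u : Fin L → M → ℝ} {p : M}
    (hu : ∀ l, MDifferentiableAt (𝓡 d) 𝓘(ℝ, ℝ) (u l) p) (hp : ∀ l, u l p ∈ Icc (0 : ℝ) 1) :
    ∑ r, (β r : ℝ≥0∞) *
      ‖mvfderiv (𝓡 d) (fun q ↦ multilinearExt (bitFun f r) fun l ↦ u l q) p‖ₑ ≤
        ∑ l, (α l : ℝ≥0∞) * ‖mvfderiv (𝓡 d) (u l) p‖ₑ := by
  set D : Fin R → Fin L → ℝ := fun r l ↦ multilinearExtDeriv (bitFun f r) l fun l ↦ u l p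
  calc
    _ ≤ ∑ r, (β r : ℝ≥0∞) * ∑ l, ‖D r l‖ₑ * ‖mvfderiv (𝓡 d) (u l) p‖ₑ := by
      gcongr with r
      rw [mvfderiv_comp_pi hu (hasFDerivAt_multilinearExt (bitFun f r) _)]
      exact enorm_sum_smul_le (V := TangentSpace (𝓡 d) p) (D r) fun l ↦ mvfderiv (𝓡 d) (u l) p
    _ = ∑ l, (∑ r, (β r : ℝ≥0∞) * ‖D r l‖ₑ) * ‖mvfderiv (𝓡 d) (u l) p‖ₑ := by
      simp only [Finset.mul_sum, Finset.sum_mul, mul_assoc]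
      exact Finset.sum_comm
    _ ≤ _ := by
      gcongr with l
      exact hf.sum_enorm_multilinearExtDeriv_le l hp

variable [MeasurableSpace M] [BorelSpace M]

/-- The infimum of the total variations of the functions in `smoothApprox d δ a V`. -/
def approxPerimeterIn (d : ℕ) {M : Type*} [EMetricSpace M]
    [ChartedSpace (EuclideanSpace ℝ (Fin d)) M]
    [RiemannianBundle (fun x : M ↦ TangentSpace (𝓡 d) x)] [MeasurableSpace M] [BorelSpace M]
    (δ : ℝ≥0∞) (a V : Set M) : ℝ≥0∞ :=
  ⨅ u ∈ smoothApprox d δ a V, ∫⁻ x in V, ‖mvfderiv (𝓡 d) u x‖ₑ ∂μHE[d]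

lemma perimeterIn_eq_iSup (a V : Set M) :
    perimeterIn d a V = ⨆ δ : {δ : ℝ≥0∞ // 0 < δ}, approxPerimeterIn d δ a V := by
  rw [iSup_subtype]
  rfl

lemma approxPerimeterIn_anti {δ δ' : ℝ≥0∞} (h : δ ≤ δ') (a V : Set M) :
    approxPerimeterIn d δ' a V ≤ approxPerimeterIn d δ a V :=
  biInf_mono fun _ hu ↦ smoothApprox_mono h a V hu

lemma perimeterIn_mono (a : Set M) {V W : Set M} (h : V ⊆ W) :
    perimeterIn d a V ≤ perimeterIn d a W := by
  simp only [perimeterIn_eq_iSup]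
  refine iSup_mono fun δ ↦ le_iInf₂ fun u hu ↦ (iInf₂_le u ⟨hu.1.mono h, fun x hx ↦ hu.2.1 x (h hx),
    (lintegral_mono_set h).trans hu.2.2⟩).trans (lintegral_mono_set h)

lemma exists_mem_smoothApprox_lintegral_le {a V : Set M} (h : perimeterIn d a V ≠ ⊤) {δ η : ℝ≥0∞}
    (hδ : 0 < δ) (hη : 0 < η) : ∃ u ∈ smoothApprox d δ a V,
      ∫⁻ x in V, ‖mvfderiv (𝓡 d) u x‖ₑ ∂μHE[d] ≤ perimeterIn d a V + η := by
  have h1 : approxPerimeterIn d δ a V ≤ perimeterIn d a V := by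
    rw [perimeterIn_eq_iSup]
    exact le_iSup (fun δ : {δ : ℝ≥0∞ // 0 < δ} ↦ approxPerimeterIn d δ a V) ⟨δ, hδ⟩
  have h2 := h1.trans_lt (ENNReal.lt_add_right h hη.ne')
  simp only [approxPerimeterIn, iInf_lt_iff] at h2
  obtain ⟨u, hu, hlt⟩ := h2
  exact ⟨u, hu, hlt.le⟩

variable [IsManifold (𝓡 d) ∞ M]
    [IsContMDiffRiemannianBundle (𝓡 d) ∞ (EuclideanSpace ℝ (Fin d))
      (fun x : M ↦ TangentSpace (𝓡 d) x)]

/-- The perimeters of sets that are combined by a contraction map. -/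
theorem IsContractionMap.sum_perimeterIn_le {L R : ℕ} {α : Fin L → ℕ} (hα : ∀ l, 0 < α l)
    {β : Fin R → ℕ} {f : (Fin L → Bool) → (Fin R → Bool)} (hf : IsContractionMap α β f)
    {V : Set M} (hV : IsOpen V) {E : Fin L → Set M} (hE : ∀ l, MeasurableSet (E l))
    {b : Fin R → Set M} (hb : ∀ r, ∀ᵐ p ∂((μHE[d] : Measure M).restrict V),
      (p ∈ b r ↔ f (membershipBits E p) r = true)) :
    ∑ r, (β r : ℝ≥0∞) * perimeterIn d (b r) V ≤ ∑ l, (α l : ℝ≥0∞) * perimeterIn d (E l) V := by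
  -- Positivity of `α` is needed here, since `0 * ⊤ = 0`.
  by_cases hfin : ∃ l, perimeterIn d (E l) V = ⊤
  · obtain ⟨l, hl⟩ := hfin
    refine le_top.trans_eq (Eq.symm (ENNReal.sum_eq_top.2 ⟨l, Finset.mem_univ l, ?_⟩))
    rw [hl, ENNReal.mul_top]
    exact_mod_cast (hα l).ne'
  push Not at hfin
  have hb' (r : Fin R) : ∀ᵐ p ∂((μHE[d] : Measure M).restrict V),
      (b r).indicator (fun _ ↦ (1 : ℝ)) p = bitFun f r (membershipBits E p) := by
    filter_upwards [hb r] with p hp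
    by_cases h : p ∈ b r <;> simp [bitFun, h, ← hp]
  choose K hK using fun r ↦
    exists_multilinearExt_mem_smoothApprox (d := d) (M := M) (bitFun f r) (bitFun_mem_Icc f r)
  have key (δ : ℝ≥0∞) (hδ : 0 < δ) (η : ℝ≥0∞) (hη : 0 < η) :
      ∑ r, (β r : ℝ≥0∞) * approxPerimeterIn d δ (b r) V ≤
        ∑ l, (α l : ℝ≥0∞) * (perimeterIn d (E l) V + η) := by
    -- One accuracy for the inputs that makes all the composites `δ`-accurate at once.
    set δ' : ℝ≥0∞ := δ / ((∑ r, K r : NNReal) + 1 : NNReal)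
    have hδ' : 0 < δ' := ENNReal.div_pos hδ.ne' ENNReal.coe_ne_top
    have hδ'' (r : Fin R) : K r * δ' ≤ δ := by
      have h1 : K r ≤ (∑ r, K r) + 1 :=
        (Finset.single_le_sum (fun _ _ ↦ zero_le) (Finset.mem_univ r)).trans (by simp)
      calc (K r : ℝ≥0∞) * δ' ≤ ((∑ r, K r : NNReal) + 1 : NNReal) * δ' := by gcongr
        _ ≤ δ := ENNReal.mul_div_le
    choose u hu hle using fun l ↦ exists_mem_smoothApprox_lintegral_le (hfin l) hδ' hη
    set g : Fin R → M → ℝ := fun r p ↦ multilinearExt (bitFun f r) fun l ↦ u l p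
    have hg (r : Fin R) : g r ∈ smoothApprox d δ (b r) V :=
      smoothApprox_mono (hδ'' r) _ _ (hK r V E (b r) δ' u hV hE (hb' r) hu)
    have hgm (r : Fin R) := aemeasurable_enorm_mvfderiv (μ := μHE[d]) hV (hg r).1
    have hum (l : Fin L) := aemeasurable_enorm_mvfderiv (μ := μHE[d]) hV (hu l).1
    calc
      _ ≤ ∑ r, (β r : ℝ≥0∞) * ∫⁻ x in V, ‖mvfderiv (𝓡 d) (g r) x‖ₑ ∂μHE[d] := by
        gcongr with r
        exact iInf₂_le (g r) (hg r)
      _ = ∫⁻ x in V, ∑ r, (β r : ℝ≥0∞) * ‖mvfderiv (𝓡 d) (g r) x‖ₑ ∂μHE[d] := by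
        rw [lintegral_finsetSum' _ fun r _ ↦ (hgm r).const_mul _]
        exact Finset.sum_congr rfl fun r _ ↦ (lintegral_const_mul'' _ (hgm r)).symm
      _ ≤ ∫⁻ x in V, ∑ l, (α l : ℝ≥0∞) * ‖mvfderiv (𝓡 d) (u l) x‖ₑ ∂μHE[d] := by
        refine setLIntegral_mono' hV.measurableSet fun x hx ↦
          sum_enorm_mvfderiv_multilinearExt_le hf (fun l ↦ ?_) fun l ↦ (hu l).2.1 x hx
        exact ((hu l).1.contMDiffAt (hV.mem_nhds hx)).mdifferentiableAt (by simp)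
      _ = ∑ l, (α l : ℝ≥0∞) * ∫⁻ x in V, ‖mvfderiv (𝓡 d) (u l) x‖ₑ ∂μHE[d] := by
        rw [lintegral_finsetSum' _ fun l _ ↦ (hum l).const_mul _]
        exact Finset.sum_congr rfl fun l _ ↦ lintegral_const_mul'' _ (hum l)
      _ ≤ _ := by
        gcongr with l
        exact hle l
  simp only [perimeterIn_eq_iSup (d := d) (b _), ENNReal.mul_iSup]
  -- The supremum over `δ` passes through the finite sum because the approximate perimeters grow as
  -- `δ` shrinks.
  rw [ENNReal.finsetSum_iSup fun δ₁ δ₂ ↦ ⟨⟨min δ₁ δ₂, lt_min δ₁.2 δ₂.2⟩, fun r ↦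
    ⟨by gcongr; exact approxPerimeterIn_anti (min_le_left _ _) _ _,
      by gcongr; exact approxPerimeterIn_anti (min_le_right _ _) _ _⟩⟩]
  refine iSup_le fun δ ↦ ?_
  refine ENNReal.le_of_forall_pos_le_add fun ε hε hlt ↦ ?_
  have hc : (∑ l, (α l : ℝ≥0∞)) + 1 ≠ ⊤ := by simp
  refine (key δ δ.2 (ε / ((∑ l, (α l : ℝ≥0∞)) + 1))
    (ENNReal.div_pos (by exact_mod_cast hε.ne') hc)).trans ?_
  simp only [mul_add, Finset.sum_add_distrib, ← Finset.sum_mul]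
  gcongr
  calc _ ≤ ((∑ l, (α l : ℝ≥0∞)) + 1) * (ε / ((∑ l, (α l : ℝ≥0∞)) + 1)) := by
        gcongr
        exact le_self_add
    _ ≤ ε := ENNReal.mul_div_le

end Perimeter

/-! ### The contraction inequality for areas -/

section AreaInequality

lemma eventually_mem_iff_of_notMem_frontier {X : Type*} [TopologicalSpace X] {s : Set X} {p : X}
    (hp : p ∉ frontier s) : ∀ᶠ q in 𝓝 p, q ∈ s ↔ p ∈ s := by
  by_cases h : p ∈ s
  · have h1 : s ∈ 𝓝 p := by
      rw [← mem_interior_iff_mem_nhds]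
      by_contra h2
      exact hp ⟨subset_closure h, h2⟩
    filter_upwards [h1] with q hq
    simp [hq, h]
  · have h1 : (closure s)ᶜ ∈ 𝓝 p := isClosed_closure.isOpen_compl.mem_nhds fun h2 ↦
      hp ⟨h2, fun h3 ↦ h (interior_subset h3)⟩
    filter_upwards [h1] with q hq
    simp only [h, iff_false]
    exact fun h2 ↦ hq (subset_closure h2)

lemma mem_interior_closure_iff_of_notMem_frontier {X : Type*} [TopologicalSpace X] {s : Set X}
    {p : X} (hp : p ∉ frontier s) : p ∈ interior (closure s) ↔ p ∈ s := by
  refine ⟨fun h ↦ ?_, fun h ↦ ?_⟩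
  · by_contra h1
    exact hp ⟨interior_subset h, fun h2 ↦ h1 (interior_subset h2)⟩
  · by_contra h1
    exact hp ⟨subset_closure h, fun h2 ↦ h1 (interior_mono subset_closure h2)⟩

lemma eventually_membershipBits_eq {X : Type*} [TopologicalSpace X] {L : ℕ} {E : Fin L → Set X}
    {p : X} (hp : ∀ l, p ∉ frontier (E l)) :
    ∀ᶠ q in 𝓝 p, membershipBits E q = membershipBits E p := by
  filter_upwards [eventually_all.2 fun l ↦ eventually_mem_iff_of_notMem_frontier (hp l)] with q hq
  funext l
  rw [Bool.eq_iff_iff, membershipBits_eq_true_iff, membershipBits_eq_true_iff, hq l]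

/-- Away from the frontiers of the `E l` the bit string is locally constant. -/
lemma frontier_membershipBits_subset {X : Type*} [TopologicalSpace X] {L : ℕ} (E : Fin L → Set X)
    (P : (Fin L → Bool) → Prop) : frontier {p | P (membershipBits E p)} ⊆ ⋃ l, frontier (E l) := by
  intro p hp
  by_contra h
  simp only [mem_iUnion, not_exists] at h
  have h1 : ∀ᶠ q in 𝓝 p, (q ∈ {p | P (membershipBits E p)} ↔ P (membershipBits E p)) := by
    filter_upwards [eventually_membershipBits_eq h] with q hq
    simp [hq]
  by_cases h2 : P (membershipBits E p)
  · refine hp.2 (mem_interior_iff_mem_nhds.2 ?_)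
    filter_upwards [h1] with q hq
    exact hq.2 h2
  · obtain ⟨q, hq, hq'⟩ := ((mem_closure_iff_frequently.1 hp.1).and_eventually h1).exists
    exact h2 (hq'.1 hq)

variable {d : ℕ} {M : Type*} [EMetricSpace M] [ChartedSpace (EuclideanSpace ℝ (Fin d)) M]
  [RiemannianBundle (fun x : M ↦ TangentSpace (𝓡 d) x)] [MeasurableSpace M] [BorelSpace M]

lemma areaIn_of_null {a U : Set M} (h : (μHE[d] : Measure M) (frontier a ∩ U) = 0) :
    areaIn d a U = ⨆ V : {V : Set M // IsOpen V ∧ IsCompact (closure V) ∧ closure V ⊆ U},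
      perimeterIn d a V := by
  rw [areaIn, if_pos h, iSup_subtype]

lemma areaIn_mono (a : Set M) {U U' : Set M} (h : U ⊆ U') : areaIn d a U ≤ areaIn d a U' := by
  by_cases h1 : (μHE[d] : Measure M) (frontier a ∩ U') = 0
  · rw [areaIn_of_null h1, areaIn_of_null (measure_mono_null (by gcongr) h1)]
    exact iSup_le fun V ↦ le_iSup (fun V : {V : Set M // IsOpen V ∧ IsCompact (closure V) ∧
      closure V ⊆ U'} ↦ perimeterIn d a V) ⟨V, V.2.1, V.2.2.1, V.2.2.2.trans h⟩
  · rw [areaIn, areaIn, if_neg h1]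
    exact le_top

/-- A relatively compact test set has its closure in a single `U m`, by compactness. -/
lemma IsCutoff.area_le_iSup {U : ℕ → Set M} (hU : IsCutoff U) (a : Set M) :
    area d a ≤ ⨆ m, areaIn d a (U m) := by
  by_cases h : ∀ m, (μHE[d] : Measure M) (frontier a ∩ U m) = 0
  · have h1 : (μHE[d] : Measure M) (frontier a ∩ univ) = 0 := by
      rw [← hU.iUnion_eq, inter_iUnion]
      exact measure_iUnion_null h
    rw [area, areaIn_of_null h1]
    refine iSup_le fun V ↦ ?_
    obtain ⟨m, hm⟩ := V.2.2.1.elim_directed_cover U hU.isOpen (by simp [hU.iUnion_eq])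
      (directed_of_isDirected_le hU.monotone)
    refine le_iSup_of_le m ?_
    rw [areaIn_of_null (h m)]
    exact le_iSup (fun V : {V : Set M // IsOpen V ∧ IsCompact (closure V) ∧
      closure V ⊆ U m} ↦ perimeterIn d a V) ⟨V, V.2.1, V.2.2.1, hm⟩
  · push Not at h
    obtain ⟨m, hm⟩ := h
    refine le_iSup_of_le m ?_
    rw [areaIn, if_neg hm]
    exact le_top

variable [IsManifold (𝓡 d) ∞ M]
    [IsContMDiffRiemannianBundle (𝓡 d) ∞ (EuclideanSpace ℝ (Fin d))
      (fun x : M ↦ TangentSpace (𝓡 d) x)]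

/-- The areas of sets that are combined by a contraction map. -/
theorem IsContractionMap.sum_areaIn_le {L R : ℕ} {α : Fin L → ℕ} (hα : ∀ l, 0 < α l)
    {β : Fin R → ℕ} {f : (Fin L → Bool) → (Fin R → Bool)} (hf : IsContractionMap α β f)
    (U : Set M) {E : Fin L → Set M} (hE : ∀ l, MeasurableSet (E l)) {b : Fin R → Set M}
    (hbE : ∀ r, frontier (b r) ⊆ ⋃ l, frontier (E l))
    (hb : ∀ r p, (∀ l, p ∉ frontier (E l)) → (p ∈ b r ↔ f (membershipBits E p) r = true)) :
    ∑ r, (β r : ℝ≥0∞) * areaIn d (b r) U ≤ ∑ l, (α l : ℝ≥0∞) * areaIn d (E l) U := by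
  by_cases hnull : ∀ l, (μHE[d] : Measure M) (frontier (E l) ∩ U) = 0
  swap
  · push Not at hnull
    obtain ⟨l, hl⟩ := hnull
    refine le_top.trans_eq (Eq.symm (ENNReal.sum_eq_top.2 ⟨l, Finset.mem_univ l, ?_⟩))
    rw [areaIn, if_neg hl, ENNReal.mul_top]
    exact_mod_cast (hα l).ne'
  have hE0 : (μHE[d] : Measure M) ((⋃ l, frontier (E l)) ∩ U) = 0 := by
    rw [iUnion_inter]
    exact measure_iUnion_null hnull
  have hb0 (r : Fin R) : (μHE[d] : Measure M) (frontier (b r) ∩ U) = 0 :=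
    measure_mono_null (inter_subset_inter_left _ (hbE r)) hE0
  simp only [fun r ↦ areaIn_of_null (hb0 r), ENNReal.mul_iSup]
  -- Test sets are directed under union, so one test set serves all `r`.
  rw [ENNReal.finsetSum_iSup fun V W ↦ ⟨⟨V ∪ W, V.2.1.union W.2.1, by
    rw [closure_union]
    exact ⟨V.2.2.1.union W.2.2.1, union_subset V.2.2.2 W.2.2.2⟩⟩, fun r ↦
    ⟨by gcongr; exact perimeterIn_mono _ subset_union_left,
      by gcongr; exact perimeterIn_mono _ subset_union_right⟩⟩]
  refine iSup_le fun V ↦ (hf.sum_perimeterIn_le hα V.2.1 hE fun r ↦ ?_).trans ?_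
  · rw [ae_restrict_iff' V.2.1.measurableSet]
    have h1 : ∀ᵐ p ∂(μHE[d] : Measure M), p ∉ (⋃ l, frontier (E l)) ∩ U :=
      measure_eq_zero_iff_ae_notMem.1 hE0
    filter_upwards [h1] with p hp hpV
    refine hb r p fun l hl ↦ hp ⟨mem_iUnion_of_mem l hl, V.2.2.2 (subset_closure hpV)⟩
  · gcongr with l
    rw [areaIn_of_null (hnull l)]
    exact le_iSup (fun V : {V : Set M // IsOpen V ∧ IsCompact (closure V) ∧
      closure V ⊆ U} ↦ perimeterIn d (E l) V) V

/-- Strong subadditivity of the area. -/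
theorem areaIn_inter_add_areaIn_union_le {a b : Set M} (ha : MeasurableSet a)
    (hb : MeasurableSet b) (U : Set M) :
    areaIn d (a ∩ b) U + areaIn d (a ∪ b) U ≤ areaIn d a U + areaIn d b U := by
  have hf : IsContractionMap (L := 2) (R := 2) (fun _ ↦ 1) (fun _ ↦ 1)
      (fun x ↦ ![x 0 && x 1, x 0 || x 1]) := by
    unfold IsContractionMap bitDist
    decide
  have h := hf.sum_areaIn_le (d := d) (fun _ ↦ one_pos) U (E := ![a, b]) (b := ![a ∩ b, a ∪ b])
    (by simp [Fin.forall_fin_two, ha, hb]) ?_ ?_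
  · simpa [Fin.sum_univ_two] using h
  · have h1 : ⋃ l, frontier (![a, b] l) = frontier a ∪ frontier b := by
      ext p
      simp [Fin.exists_fin_two]
    rw [h1, Fin.forall_fin_two]
    exact ⟨(frontier_inter_subset a b).trans
      (union_subset_union inter_subset_left inter_subset_right),
      (frontier_union_subset a b).trans
      (union_subset_union inter_subset_left inter_subset_right)⟩
  · intro r p _
    revert r
    simp [Fin.forall_fin_two, membershipBits_eq_true_iff]

end AreaInequality

/-! ### Wedge unions and conformal boundaries -/

section Boundary

/-- For two sets: the part of the open set `interior (A ∪ B) \ C` outside `B` is open and inside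
`A`, hence in `C`, hence empty. The whole set is then inside `interior B`, so it is empty too. -/
lemma interior_iUnion_subset_of_isClosed {X κ : Type*} [TopologicalSpace X] [Finite κ]
    {A : κ → Set X} (hA : ∀ k, IsClosed (A k)) {C : Set X} (hC : IsClosed C)
    (h : ∀ k, interior (A k) ⊆ C) : interior (⋃ k, A k) ⊆ C := by
  have two (A B : Set X) (hB : IsClosed B) (h1 : interior A ⊆ C) (h2 : interior B ⊆ C) :
      interior (A ∪ B) ⊆ C := by
    have h3 : (interior (A ∪ B) \ C) \ B ⊆ interior A :=
      interior_maximal (fun p hp ↦ (interior_subset hp.1.1).resolve_right hp.2)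
        ((isOpen_interior.sdiff hC).sdiff hB)
    have h4 : interior (A ∪ B) \ C ⊆ interior B :=
      interior_maximal (fun p hp ↦ by_contra fun hpB ↦ hp.2 (h1 (h3 ⟨hp, hpB⟩)))
        (isOpen_interior.sdiff hC)
    exact fun p hp ↦ by_contra fun hpC ↦ hpC (h2 (h4 ⟨hp, hpC⟩))
  have := Fintype.ofFinite κ
  have fin (s : Finset κ) : interior (⋃ k ∈ s, A k) ⊆ C := by
    classical
    induction s using Finset.induction_on with
    | empty => simp
    | insert k s _ ih =>
      rw [Finset.set_biUnion_insert, union_comm]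
      exact two _ _ (hA k) ih (h k)
  simpa using fin Finset.univ

variable {M Mt : Type*} [TopologicalSpace Mt]

lemma mem_conformalBoundary_iff {ι : M → Mt} {a : Set M} {p : ↥(range ι)ᶜ} :
    p ∈ conformalBoundary ι a ↔ (p : Mt) ∈ closure (ι '' a) :=
  ⟨fun h ↦ h.1, fun h ↦ ⟨h, fun h' ↦ p.2 (image_subset_range _ _ (interior_subset h'))⟩⟩

lemma isClosed_conformalBoundary (ι : M → Mt) (a : Set M) : IsClosed (conformalBoundary ι a) :=
  isClosed_frontier.preimage continuous_subtype_val

lemma conformalBoundary_mono (ι : M → Mt) {a b : Set M} (h : a ⊆ b) :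
    conformalBoundary ι a ⊆ conformalBoundary ι b := fun _ hp ↦
  mem_conformalBoundary_iff.2 (closure_mono (image_mono h) (mem_conformalBoundary_iff.1 hp))

lemma conformalBoundary_iUnion {κ : Type*} [Finite κ] (ι : M → Mt) (a : κ → Set M) :
    conformalBoundary ι (⋃ k, a k) = ⋃ k, conformalBoundary ι (a k) := by
  ext p
  simp [mem_conformalBoundary_iff, image_iUnion, closure_iUnion_of_finite]

lemma SameConformalBoundary.of_subset {ι : M → Mt} {a b : Set M} (h : a ⊆ b)
    (h' : interior (conformalBoundary ι b) ⊆ conformalBoundary ι a) :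
    SameConformalBoundary ι a b :=
  (interior_mono (conformalBoundary_mono ι h)).antisymm (interior_maximal h' isOpen_interior)

/-- If the regions `a i` reach their conformal boundaries in full collars, then the union of the
cells of the partition generated by `E` whose bit strings satisfy `P` has, up to edges, no conformal
boundary apart from that of the regions `a i` that it contains. -/
lemma interior_conformalBoundary_cells_subset {n L : ℕ} {ι : M → Mt}
    (hι : Function.Injective ι) {a : Fin n → Set M} (hcollar : ∀ i, HasCollar ι (a i))
    {E : Fin L → Set M} {x : Fin n → Fin L → Bool}
    (hx : ∀ i, ∀ p ∈ a i, membershipBits E p = x i)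
    (hE : ∀ l, interior (conformalBoundary ι (E l)) ⊆
      ⋃ i : {i | x i l = true}, conformalBoundary ι (a i))
    (P : (Fin L → Bool) → Prop) (hP : ¬ P fun _ ↦ false) :
    interior (conformalBoundary ι {p | P (membershipBits E p)}) ⊆
      ⋃ i : {i | P (x i)}, conformalBoundary ι (a i) := by
  have hC : IsClosed (⋃ i : {i | P (x i)}, conformalBoundary ι (a i)) :=
    isClosed_iUnion_of_finite fun i ↦ isClosed_conformalBoundary ι _
  have hcells : {p | P (membershipBits E p)} =
      ⋃ z : {z : Fin L → Bool // P z}, {p | membershipBits E p = z} := by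
    ext p
    simp
  rw [hcells, conformalBoundary_iUnion]
  refine interior_iUnion_subset_of_isClosed (fun _ ↦ isClosed_conformalBoundary ι _) hC ?_
  rintro ⟨z, hz⟩
  -- The cell outside every `E l` is excluded by `hP`, so this cell lies in some `E l` and its
  -- boundary is controlled by `hE`.
  obtain ⟨l, hl⟩ : ∃ l, z l = true := by
    by_contra! h
    exact hP (by rwa [show (fun _ ↦ false) = z from funext fun l ↦ by simpa using (h l).symm])
  set O := interior (conformalBoundary ι {p | membershipBits E p = z}) with hO
  have hOE : O ⊆ ⋃ i : {i | x i l = true}, conformalBoundary ι (a i) := by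
    refine (interior_mono (conformalBoundary_mono ι fun p hp ↦ ?_)).trans (hE l)
    rw [← membershipBits_eq_true_iff, show membershipBits E p = z from hp, hl]
  have key := interior_iUnion_subset_of_isClosed
    (fun i : {i | x i l = true} ↦ isClosed_conformalBoundary ι (a i))
    (hC.union (isOpen_interior (s := conformalBoundary ι
      {p | membershipBits E p = z})).isClosed_compl)
    fun i q hq ↦ ?_
  · intro q hq
    exact (key (interior_maximal hOE isOpen_interior hq)).resolve_right fun h ↦ h hq
  -- A boundary point of the cell inside the collar of `a i` forces the cell to meet `a i`; then its
  -- bit string is `x i`, and `P (x i)` holds.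
  · by_cases hqO : q ∈ O
    · have hq1 := mem_conformalBoundary_iff.1 (interior_subset hqO)
      obtain ⟨_, h1, p, hp, rfl⟩ := mem_closure_iff_nhds.1 hq1 _ (hcollar i q hq)
      have h2 : p ∈ a i := by
        obtain ⟨p', hp', h⟩ | h := h1
        · rwa [← hι h]
        · exact absurd (mem_range_self p) h
      have h3 : P (x i) := by rwa [← hx i p h2, show membershipBits E p = z from hp]
      exact Or.inl (mem_iUnion_of_mem ⟨i, h3⟩ (interior_subset hq))
    · exact Or.inr hqO

variable [TopologicalSpace M]

lemma wedgeUnion_eq {κ : Type*} (a : κ → Set M) (s : Set κ) :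
    wedgeUnion a s = interior (closure (⋃ i ∈ s, a i)) := by
  rw [wedgeUnion, wedgeCompl, wedgeCompl, interior_compl (s := ⋃ i ∈ s, a i), compl_compl]

lemma subset_wedgeUnion {κ : Type*} {a : κ → Set M} (ha : ∀ i, IsOpen (a i)) {s : Set κ} {i : κ}
    (hi : i ∈ s) : a i ⊆ wedgeUnion a s := by
  rw [wedgeUnion_eq]
  exact interior_maximal ((subset_biUnion_of_mem hi).trans subset_closure) (ha i)

lemma wedgeUnion_mono {κ : Type*} (a : κ → Set M) {s t : Set κ} (h : s ⊆ t) :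
    wedgeUnion a s ⊆ wedgeUnion a t := by
  simp only [wedgeUnion_eq]
  exact interior_mono (closure_mono (biUnion_mono h fun _ _ ↦ subset_rfl))

lemma conformalBoundary_subset_of_subset_closure {ι : M → Mt} (hι : Continuous ι) {a b : Set M}
    (h : a ⊆ closure b) : conformalBoundary ι a ⊆ conformalBoundary ι b := fun p hp ↦ by
  rw [mem_conformalBoundary_iff] at hp ⊢
  exact closure_minimal ((image_mono h).trans (image_closure_subset_closure_image hι))
    isClosed_closure hp

/-- The wedge union lies between the union and its closure in the slice, and these have the same
conformal boundary. -/
lemma conformalBoundary_wedgeUnion {κ : Type*} [Finite κ] {ι : M → Mt} (hι : Continuous ι)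
    {a : κ → Set M} (ha : ∀ i, IsOpen (a i)) (s : Set κ) :
    conformalBoundary ι (wedgeUnion a s) = ⋃ i : s, conformalBoundary ι (a i) := by
  rw [← conformalBoundary_iUnion, ← biUnion_eq_iUnion s fun i _ ↦ a i]
  refine (conformalBoundary_subset_of_subset_closure hι ?_).antisymm (conformalBoundary_mono ι ?_)
  · rw [wedgeUnion_eq]
    exact interior_subset
  · exact iUnion₂_subset fun i hi ↦ subset_wedgeUnion ha hi

end Boundary

/-! ### Entanglement wedges -/

section EntanglementWedge

variable {d : ℕ} {M : Type*} [EMetricSpace M] [ChartedSpace (EuclideanSpace ℝ (Fin d)) M]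
  [IsManifold (𝓡 d) ∞ M] [RiemannianBundle (fun x : M ↦ TangentSpace (𝓡 d) x)]
  [IsContMDiffRiemannianBundle (𝓡 d) ∞ (EuclideanSpace ℝ (Fin d))
      (fun x : M ↦ TangentSpace (𝓡 d) x)] [MeasurableSpace M] [BorelSpace M]
  {Mt : Type*} [TopologicalSpace Mt] {ι : M → Mt} {U : ℕ → Set M}

/-- Intersecting a region with an entanglement wedge of a larger region does not increase
its area. -/
lemma IsEntanglementWedge.eventually_areaIn_inter_le {a b e F : Set M}
    (hF : IsEntanglementWedge d ι U b F) (hab : a ⊆ b) (he : IsOpen e)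
    (hae : interior (conformalBoundary ι e) ⊆ conformalBoundary ι a) {ε : ℝ≥0∞} (hε : 0 < ε) :
    ∀ᶠ m in atTop, areaIn d (e ∩ F) (U m) ≤ areaIn d e (U m) + ε := by
  -- The union `e ∪ F` competes with `F`; strong subadditivity then moves the gain to `e ∩ F`.
  have hcb : SameConformalBoundary ι b (e ∪ F) := by
    refine .of_subset (hF.subset.trans subset_union_right) ?_
    rw [union_eq_iUnion, conformalBoundary_iUnion]
    refine interior_iUnion_subset_of_isClosed (fun _ ↦ isClosed_conformalBoundary ι _)
      (isClosed_conformalBoundary ι b) (Bool.forall_bool.2 ⟨?_, ?_⟩)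
    · exact hF.sameConformalBoundary.symm.subset.trans interior_subset
    · exact hae.trans (conformalBoundary_mono ι hab)
  filter_upwards [hF.minimal (e ∪ F) (he.union hF.isOpen) (hF.subset.trans subset_union_right) hcb
    ε hε] with m hm
  -- Cancelling the area of `F` requires its cut-off areas to be finite.
  refine (ENNReal.add_le_add_iff_right (hF.areaIn_lt_top m).ne).1 ?_
  calc areaIn d (e ∩ F) (U m) + areaIn d F (U m)
      ≤ areaIn d (e ∩ F) (U m) + (areaIn d (e ∪ F) (U m) + ε) := by gcongr
    _ ≤ areaIn d e (U m) + areaIn d F (U m) + ε := by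
      rw [← add_assoc]
      exact add_le_add
        (areaIn_inter_add_areaIn_union_le he.measurableSet hF.isOpen.measurableSet _) le_rfl
    _ = areaIn d e (U m) + ε + areaIn d F (U m) := by ring

/-- An entanglement wedge can be shrunk, without increasing its area, so that it is contained in
given entanglement wedges of larger regions. -/
lemma IsEntanglementWedge.exists_subset_finset {κ : Type*} {a e : Set M}
    (he : IsEntanglementWedge d ι U a e) {b F : κ → Set M}
    (hF : ∀ k, IsEntanglementWedge d ι U (b k) (F k)) (s : Finset κ) (hab : ∀ k ∈ s, a ⊆ b k) :
    ∃ e', IsOpen e' ∧ a ⊆ e' ∧ e' ⊆ e ∧ (∀ k ∈ s, e' ⊆ F k) ∧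
      ∀ ε : ℝ≥0∞, 0 < ε → ∀ᶠ m in atTop, areaIn d e' (U m) ≤ areaIn d e (U m) + ε := by
  classical
  induction s using Finset.induction_on with
  | empty => exact ⟨e, he.isOpen, he.subset, subset_rfl, by simp, fun ε _ ↦ by simp⟩
  | insert k s _ ih =>
    obtain ⟨e', ho, hae, hee, hs, harea⟩ := ih fun j hj ↦ hab j (Finset.mem_insert_of_mem hj)
    have hk := hab k (Finset.mem_insert_self k s)
    refine ⟨e' ∩ F k, ho.inter (hF k).isOpen, subset_inter hae (hk.trans (hF k).subset),
      inter_subset_left.trans hee, fun j hj ↦ ?_, fun ε hε ↦ ?_⟩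
    · obtain rfl | hj := Finset.mem_insert.1 hj
      · exact inter_subset_right
      · exact inter_subset_left.trans (hs j hj)
    · have hcb : interior (conformalBoundary ι e') ⊆ conformalBoundary ι a :=
        (interior_mono (conformalBoundary_mono ι hee)).trans
          (he.sameConformalBoundary.symm.subset.trans interior_subset)
      filter_upwards [harea (ε / 2) (ENNReal.half_pos hε.ne'),
        (hF k).eventually_areaIn_inter_le hk ho hcb (ENNReal.half_pos hε.ne')] with m h1 h2
      calc _ ≤ areaIn d e (U m) + ε / 2 + ε / 2 := h2.trans (by gcongr)
        _ = _ := by rw [add_assoc, ENNReal.add_halves]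

end EntanglementWedge

/-! ### Assembling the entropy inequality -/

lemma eventually_sum_mul_le_add {R : ℕ} (β : Fin R → ℕ) {A B : Fin R → ℕ → ℝ≥0∞}
    (h : ∀ r, ∀ ε : ℝ≥0∞, 0 < ε → ∀ᶠ m in atTop, A r m ≤ B r m + ε) {ε : ℝ≥0∞} (hε : 0 < ε) :
    ∀ᶠ m in atTop, ∑ r, (β r : ℝ≥0∞) * A r m ≤ (∑ r, (β r : ℝ≥0∞) * B r m) + ε := by
  have hc : (∑ r, (β r : ℝ≥0∞)) + 1 ≠ ⊤ := by simp
  set η := ε / ((∑ r, (β r : ℝ≥0∞)) + 1) with hη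
  filter_upwards [eventually_all.2 fun r ↦ h r η (ENNReal.div_pos hε.ne' hc)] with m hm
  calc _ ≤ ∑ r, (β r : ℝ≥0∞) * (B r m + η) := by
        gcongr with r
        exact hm r
    _ = (∑ r, (β r : ℝ≥0∞) * B r m) + (∑ r, (β r : ℝ≥0∞)) * η := by
        simp only [mul_add, Finset.sum_add_distrib, ← Finset.sum_mul]
    _ ≤ (∑ r, (β r : ℝ≥0∞) * B r m) + ((∑ r, (β r : ℝ≥0∞)) + 1) * η := by
        gcongr
        exact le_self_add
    _ ≤ _ := by
        gcongr
        exact ENNReal.mul_div_le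

end StaticHEC

end

open StaticHEC

theorem mainTheorem1 {d : ℕ} {M : Type*} [EMetricSpace M]
    [ChartedSpace (EuclideanSpace ℝ (Fin d)) M] [IsManifold (𝓡 d) ∞ M]
    [RiemannianBundle (fun x : M ↦ TangentSpace (𝓡 d) x)]
    [IsContMDiffRiemannianBundle (𝓡 d) ∞ (EuclideanSpace ℝ (Fin d))
      (fun x : M ↦ TangentSpace (𝓡 d) x)]
    [IsRiemannianManifold (𝓡 d) M] [MeasurableSpace M] [BorelSpace M]
    {Mt : Type*} [TopologicalSpace Mt] (ι : M → Mt) (hι : IsOpenEmbedding ι)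
    (U : ℕ → Set M) (hU : StaticHEC.IsCutoff U)
    {n L R : ℕ} (a : Fin n → Set M) (ha : ∀ i, IsOpen (a i))
    (hcollar : ∀ i, StaticHEC.HasCollar ι (a i))
    (F : Fin n → Set M)
    (hF : ∀ i, StaticHEC.IsEntanglementWedge d ι U (StaticHEC.wedgeUnion a {j | j ≠ i}) (F i))
    (hindep : ∀ i, a i ⊆ StaticHEC.wedgeCompl (F i))
    (x : Fin n → Fin L → Bool) (y : Fin n → Fin R → Bool)
    (Ev : Fin L → Set M)
    (hEv : ∀ l, StaticHEC.IsEntanglementWedge d ι U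
      (StaticHEC.wedgeUnion a {i | x i l = true}) (Ev l))
    (Ew : Fin R → Set M)
    (hEw : ∀ r, StaticHEC.IsEntanglementWedge d ι U
      (StaticHEC.wedgeUnion a {i | y i r = true}) (Ew r))
    (α : Fin L → ℕ) (hα : ∀ l, 0 < α l) (β : Fin R → ℕ) (hβ : ∀ r, 0 < β r)
    (f : (Fin L → Bool) → (Fin R → Bool)) (hf : StaticHEC.IsContractionMap α β f)
    (hf0 : f (fun _ ↦ false) = fun _ ↦ false) (hfx : ∀ i, f (x i) = y i) :
    (∑ r, (β r : ℝ≥0∞) * StaticHEC.area d (Ew r) ≤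
      ∑ l, (α l : ℝ≥0∞) * StaticHEC.area d (Ev l)) ∧
    ∀ ε : ℝ≥0∞, 0 < ε → ∀ᶠ m in atTop,
      ∑ r, (β r : ℝ≥0∞) * StaticHEC.areaIn d (Ew r) (U m) ≤
        (∑ l, (α l : ℝ≥0∞) * StaticHEC.areaIn d (Ev l) (U m)) + ε := by
  -- If `x i l = false`, the index `i` does not occur in `v_l`, so `v_l` is contained in the wedge
  -- union over `j ≠ i`, whose wedge is `F i`.
  choose E hEo hvE hEEv hEF hEarea using fun l ↦ (hEv l).exists_subset_finset hF
    (Finset.univ.filter fun i ↦ x i l = false) fun i hi ↦ wedgeUnion_mono a fun j hj ↦ by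
      rintro rfl
      simp_all
  have hbits (i : Fin n) (p : M) (hp : p ∈ a i) : membershipBits E p = x i := by
    funext l
    cases h : x i l
    · rw [← Bool.not_eq_true, membershipBits_eq_true_iff]
      exact fun h1 ↦ interior_subset (hindep i hp) (hEF l i (by simp [h]) h1)
    · exact membershipBits_eq_true_iff.2 (hvE l (subset_wedgeUnion ha (by exact h) hp))
  have hEcb (l : Fin L) : interior (conformalBoundary ι (E l)) ⊆
      ⋃ i : {i | x i l = true}, conformalBoundary ι (a i) := by
    rw [← conformalBoundary_wedgeUnion hι.continuous ha]
    exact (interior_mono (conformalBoundary_mono ι (hEEv l))).trans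
      ((hEv l).sameConformalBoundary.symm.subset.trans interior_subset)
  let S : Fin R → Set M := fun r ↦ {p | f (membershipBits E p) r = true}
  -- `S r` contains the relevant `a i`, but it need not be open or contain their wedge union.
  -- Regularising repairs both and changes `S r` only on the frontiers of the `E l`.
  let b : Fin R → Set M := fun r ↦ interior (closure (S r))
  have hwb (r : Fin R) : wedgeUnion a {i | y i r = true} ⊆ b r := by
    rw [wedgeUnion_eq]
    refine interior_mono (closure_mono (iUnion₂_subset fun i hi p hp ↦ ?_))
    change f (membershipBits E p) r = true
    rw [hbits i p hp, hfx]
    exact hi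
  have hbcb (r : Fin R) : SameConformalBoundary ι (wedgeUnion a {i | y i r = true}) (b r) := by
    have hy : {i | y i r = true} = {i | f (x i) r = true} := by simp only [hfx]
    refine .of_subset (hwb r) ?_
    rw [hy, conformalBoundary_wedgeUnion hι.continuous ha]
    refine (interior_mono (conformalBoundary_subset_of_subset_closure hι.continuous
      interior_subset)).trans ?_
    exact interior_conformalBoundary_cells_subset hι.injective hcollar hbits hEcb
      (fun z ↦ f z r = true) (by simp [hf0])
  have hS (r : Fin R) : frontier (S r) ⊆ ⋃ l, frontier (E l) :=
    frontier_membershipBits_subset E fun z ↦ f z r = true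
  have hsum (m : ℕ) : ∑ r, (β r : ℝ≥0∞) * areaIn d (b r) (U m) ≤
      ∑ l, (α l : ℝ≥0∞) * areaIn d (E l) (U m) :=
    hf.sum_areaIn_le hα (U m) (fun l ↦ (hEo l).measurableSet)
      (fun r ↦ frontier_interior_subset.trans (frontier_closure_subset.trans (hS r)))
      fun r p hp ↦ mem_interior_closure_iff_of_notMem_frontier fun h ↦ by
        obtain ⟨l, hl⟩ := mem_iUnion.1 (hS r h)
        exact hp l hl
  have hcut (ε : ℝ≥0∞) (hε : 0 < ε) : ∀ᶠ m in atTop,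
      ∑ r, (β r : ℝ≥0∞) * areaIn d (Ew r) (U m) ≤
        (∑ l, (α l : ℝ≥0∞) * areaIn d (Ev l) (U m)) + ε := by
    have hε2 := ENNReal.half_pos hε.ne'
    filter_upwards [eventually_sum_mul_le_add β
      (fun r ↦ (hEw r).minimal (b r) isOpen_interior (hwb r) (hbcb r)) hε2,
      eventually_sum_mul_le_add α hEarea hε2] with m h1 h2
    calc _ ≤ (∑ l, (α l : ℝ≥0∞) * areaIn d (Ev l) (U m)) + ε / 2 + ε / 2 :=
          h1.trans (by gcongr; exact (hsum m).trans h2)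
      _ = _ := by rw [add_assoc, ENNReal.add_halves]
  refine ⟨?_, hcut⟩
  refine ENNReal.le_of_forall_pos_le_add fun ε hε _ ↦ ?_
  -- Cut-off areas increase with `m`, so the bound for late cutoffs controls every earlier one and
  -- hence the supremum.
  have hmono (r : Fin R) : Monotone fun m ↦ (β r : ℝ≥0∞) * areaIn d (Ew r) (U m) :=
    fun i j hij ↦ by
      dsimp only
      gcongr
      exact areaIn_mono _ (hU.monotone hij)
  calc ∑ r, (β r : ℝ≥0∞) * area d (Ew r)
      ≤ ∑ r, ⨆ m, (β r : ℝ≥0∞) * areaIn d (Ew r) (U m) := by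
        gcongr with r
        rw [← ENNReal.mul_iSup]
        gcongr
        exact hU.area_le_iSup _
    _ = ⨆ m, ∑ r, (β r : ℝ≥0∞) * areaIn d (Ew r) (U m) :=
        ENNReal.finsetSum_iSup_of_monotone hmono
    _ ≤ _ := iSup_le fun m ↦ by
        obtain ⟨k, hk, hmk⟩ := ((hcut ε (by exact_mod_cast hε)).and (eventually_ge_atTop m)).exists
        calc _ ≤ ∑ r, (β r : ℝ≥0∞) * areaIn d (Ew r) (U k) :=
              Finset.sum_le_sum fun r _ ↦ hmono r hmk
          _ ≤ _ := hk
          _ ≤ _ := by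
              gcongr with l
              exact areaIn_mono _ (subset_univ _)
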